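/- For a commutative ring $B$ and $n\ge 0$ let $W_n(B)=(1+tB[[t]])/(1+t^{n+1}B[[t]])$ be the group (written additively) of generalized Witt vectors of length $n$ over $B$. For $a\in B$ let $[a]$ be the class of $(1-at)^{-1}$; $a\mapsto[a]$ identifies $B$ with $W_1(B)$. The substitution $t\mapsto t^N$ induces the Verschiebung $V_N: W_n(B)\to W_{nN+N-1}(B)$, and for $k\le n$ there is the truncation map $W_n(B)\to W_k(B)$. On a scheme $X$ let $W_n\mathcal O_X$ be the Zariski sheaf associated with $U\mapsto W_n(\mathcal O_X(U))$; thus $W_1\mathcal O_X=\mathcal O_X$. Let $A$ be a commutative ring that is flat over $\mathbb Z$, and let $f:X\to S=\mathrm{Spec}\,A$ be a morphism of schemes such that $H^j(X,\mathcal O_X)$ is a free $A$-module for every $j\ge 0$. (This holds in particular if $f$ is smooth and projective, $A$ is étale over a polynomial ring $\mathbb Z[\frac12][x_1,\dots,x_r]$, and all $H^m_{DR}(X/S)$ and all $H^{j}(X,\Omega^i_{X/S})$ are free $A$-modules.) Then for all $j\ge 0$ and all $N\ge 2$ the sequence $$0\to H^j(X,\mathcal O_X)\xrightarrow{\,V_N\,}H^j(X,W_N\mathcal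 O_X)\to H^j(X,W_{N-1}\mathcal O_X)\to 0$$ is exact, where $V_N$ denotes the map induced by $V_N:\mathcal O_X=W_1\mathcal O_X\to W_{2N-1}\mathcal O_X$ followed by truncation to $W_N\mathcal O_X$, and the second map is induced by truncation. Moreover the map induced by truncation $$H^j(X,W_N\mathcal O_X)\to H^j(X,\mathcal O_X)$$ (that is, the truncation map $H^j(X,W_N\Omega^i_{X/S})\to H^j(X,\Omega^i_{X/S})$ for $i=0$) is surjective for all $j\ge 0$ and all $N\ge 2$. -/

import Mathlib

open CategoryTheory AlgebraicGeometry TopologicalSpace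

universe u

noncomputable section

namespace GenWitt

/-! ### Generalized (big) Witt vectors of finite length -/

section Algebra

variable (A : Type*) [CommRing A] {B : Type*} [CommRing B]

/-- The multiplicative group `1 + t^(n+1) A[[t]]`, as a subgroup of the units of `A[[t]]`.
For `n = 0` this is the group `1 + t A[[t]]` of all generalized Witt vectors of `A`. -/
def fil (n : ℕ) : Subgroup (PowerSeries A)ˣ where
  carrier := {u | (PowerSeries.X : PowerSeries A) ^ (n + 1) ∣ (u : PowerSeries A) - 1}
  one_mem' := by simp
  mul_mem' := by
    intro a b ha hb
    have h : ((a * b : (PowerSeries A)ˣ) : PowerSeries A) - 1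
        = ((a : PowerSeries A) - 1) * b + ((b : PowerSeries A) - 1) := by
      push_cast; ring
    simp only [Set.mem_ofPred_eq] at *
    rw [h]
    exact dvd_add (ha.mul_right _) hb
  inv_mem' := by
    intro a ha
    have h : ((a⁻¹ : (PowerSeries A)ˣ) : PowerSeries A) - 1
        = ((a : PowerSeries A) - 1) * (-((a⁻¹ : (PowerSeries A)ˣ) : PowerSeries A)) := by
      rw [mul_neg, sub_mul, Units.mul_inv]; ring
    simp only [Set.mem_ofPred_eq] at *
    rw [h]
    exact ha.mul_right _

variable {A} in
lemma mem_fil {n : ℕ} {u : (PowerSeries A)ˣ} :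
    u ∈ fil A n ↔ (PowerSeries.X : PowerSeries A) ^ (n + 1) ∣ (u : PowerSeries A) - 1 :=
  Iff.rfl

variable {A} in
lemma fil_anti {k n : ℕ} (h : k ≤ n) {u : (PowerSeries A)ˣ} (hu : u ∈ fil A n) :
    u ∈ fil A k :=
  (pow_dvd_pow _ (by omega)).trans hu

/-- The additive group `W_n(A)` of generalized Witt vectors of length `n`: the group
`(1 + t A[[t]]) / (1 + t^(n+1) A[[t]])` written additively. -/
abbrev Wn (n : ℕ) : Type _ :=
  Additive (fil A 0 ⧸ (fil A n).subgroupOf (fil A 0))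

variable {A} in
/-- The class in `W_n(A)` of a power series with constant term `1`. -/
def Wn.mk (n : ℕ) (u : (PowerSeries A)ˣ) (hu : u ∈ fil A 0) : Wn A n :=
  Additive.ofMul (QuotientGroup.mk ⟨u, hu⟩)

variable {A}

lemma Wn.exists_mk {n : ℕ} (x : Wn A n) : ∃ u hu, x = Wn.mk n u hu := by
  obtain ⟨y, hy⟩ := QuotientGroup.mk_surjective x.toMul
  exact ⟨y.1, y.2, (congrArg Additive.ofMul hy).symm⟩

/-- The map `W_n(A) → W_k(B)` induced by a homomorphism of groups of units of power series which
is compatible with the filtrations. -/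
def Wn.lift {n k : ℕ} (φ : (PowerSeries A)ˣ →* (PowerSeries B)ˣ)
    (h₀ : ∀ u ∈ fil A 0, φ u ∈ fil B 0) (h : ∀ u ∈ fil A n, φ u ∈ fil B k) :
    Wn A n →+ Wn B k :=
  MonoidHom.toAdditive
    (QuotientGroup.map _ _
      ((φ.comp (fil A 0).subtype).codRestrict (fil B 0) (fun u => h₀ u.1 u.2))
      (fun u hu => h u.1 hu))

@[simp]
lemma Wn.lift_mk {n k : ℕ} (φ : (PowerSeries A)ˣ →* (PowerSeries B)ˣ)
    (h₀ : ∀ u ∈ fil A 0, φ u ∈ fil B 0) (h : ∀ u ∈ fil A n, φ u ∈ fil B k)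
    (u : (PowerSeries A)ˣ) (hu : u ∈ fil A 0) :
    Wn.lift φ h₀ h (Wn.mk n u hu) = Wn.mk k (φ u) (h₀ u hu) :=
  rfl

lemma map_mem_fil (g : A →+* B) {n : ℕ} {u : (PowerSeries A)ˣ} (hu : u ∈ fil A n) :
    Units.map (PowerSeries.map g : PowerSeries A →* PowerSeries B) u ∈ fil B n := by
  have h := map_dvd (PowerSeries.map g) (mem_fil.1 hu)
  simpa [mem_fil] using h

/-- Functoriality of `W_n`: apply a ring homomorphism to all the coefficients. -/
def Wn.map (n : ℕ) (g : A →+* B) : Wn A n →+ Wn B n :=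
  Wn.lift (Units.map (PowerSeries.map g : PowerSeries A →* PowerSeries B))
    (fun _ hu => map_mem_fil g hu) (fun _ hu => map_mem_fil g hu)

variable (A) in
/-- The truncation map `W_n(A) → W_k(A)` for `k ≤ n`. -/
def Wn.trunc {n k : ℕ} (h : k ≤ n) : Wn A n →+ Wn A k :=
  Wn.lift (MonoidHom.id _) (fun _ hu => hu) (fun _ hu => fil_anti h hu)

lemma expand_mem_fil {m : ℕ} (hm : m ≠ 0) {n k : ℕ} (hk : k + 1 ≤ (n + 1) * m)
    {u : (PowerSeries A)ˣ} (hu : u ∈ fil A n) :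
    Units.map (PowerSeries.expand (R := A) m hm : PowerSeries A →* PowerSeries A) u ∈ fil A k := by
  have h := map_dvd (PowerSeries.expand m hm) (mem_fil.1 hu)
  rw [map_pow, PowerSeries.expand_X, ← pow_mul, map_sub, map_one] at h
  exact (pow_dvd_pow _ (by rwa [mul_comm m])).trans h

variable (A) in
/-- The Verschiebung `V_m : W_n(A) → W_{nm+m-1}(A)`, induced by the substitution `t ↦ t^m`. -/
def Wn.verschiebung (m : ℕ) (hm : m ≠ 0) (n : ℕ) : Wn A n →+ Wn A (n * m + m - 1) :=
  Wn.lift (Units.map (PowerSeries.expand (R := A) m hm : PowerSeries A →* PowerSeries A))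
    (fun _ hu => expand_mem_fil hm (by omega) hu)
    (fun _ hu => expand_mem_fil hm (by rw [add_mul, one_mul]; omega) hu)

/-- The power series `(1 - a t)⁻¹`, as a unit. -/
def teichUnit (a : A) : (PowerSeries A)ˣ :=
  (Units.mk (1 - PowerSeries.C a * PowerSeries.X) (PowerSeries.mk fun n => a ^ n)
    (by
      ext n
      rcases n with _ | n
      · simp
      · simp [sub_mul, mul_assoc, PowerSeries.coeff_succ_X_mul, PowerSeries.coeff_one,
          pow_succ']
    )
    (by
      rw [mul_comm]
      ext n
      rcases n with _ | n
      · simp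
      · simp [sub_mul, mul_assoc, PowerSeries.coeff_succ_X_mul, PowerSeries.coeff_one,
          pow_succ']))⁻¹

lemma coeff_teichUnit (a : A) (n : ℕ) :
    PowerSeries.coeff n (teichUnit a : PowerSeries A) = a ^ n := by
  simp [teichUnit]

lemma teichUnit_mem (a : A) : teichUnit a ∈ fil A 0 := by
  rw [mem_fil, PowerSeries.X_pow_dvd_iff]
  intro m hm
  obtain rfl : m = 0 := by omega
  rw [map_sub, coeff_teichUnit]
  simp

/-- The Teichmüller lift `[a] = (1 - a t)⁻¹` in `W_n(A)`. -/
def teichmuller (n : ℕ) (a : A) : Wn A n := Wn.mk n (teichUnit a) (teichUnit_mem a)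

lemma coeff_zero_of_mem {u : (PowerSeries A)ˣ} (hu : u ∈ fil A 0) :
    PowerSeries.coeff 0 (u : PowerSeries A) = 1 := by
  have h := PowerSeries.X_pow_dvd_iff.1 (mem_fil.1 hu) 0 (by omega)
  rw [map_sub, sub_eq_zero] at h
  simpa using h

lemma mem_fil_one {u : (PowerSeries A)ˣ} (hu : u ∈ fil A 0)
    (h1 : PowerSeries.coeff 1 (u : PowerSeries A) = 0) : u ∈ fil A 1 := by
  rw [mem_fil, PowerSeries.X_pow_dvd_iff]
  intro m hm
  rw [map_sub]
  have : m = 0 ∨ m = 1 := by omega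
  rcases this with rfl | rfl
  · rw [coeff_zero_of_mem hu]; simp
  · rw [h1]; simp [PowerSeries.coeff_one]

variable (A) in
/-- The coefficient of `t`, as a homomorphism `1 + t A[[t]] → A`. -/
def coeffOneHom : fil A 0 →* Multiplicative A where
  toFun u := Multiplicative.ofAdd (PowerSeries.coeff 1 ((u : (PowerSeries A)ˣ) : PowerSeries A))
  map_one' := by
    rw [← ofAdd_zero]
    simp [PowerSeries.coeff_one]
  map_mul' := by
    rintro ⟨u, hu⟩ ⟨v, hv⟩
    rw [← ofAdd_add]
    have h1 := coeff_zero_of_mem hu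
    have h2 := coeff_zero_of_mem hv
    congr 1
    simp only [Subgroup.coe_mul, Units.val_mul, PowerSeries.coeff_mul]
    rw [Finset.Nat.sum_antidiagonal_eq_sum_range_succ_mk]
    simp only [Finset.sum_range_succ, Finset.sum_range_zero]
    simp only [Nat.sub_zero, Nat.sub_self, h1, h2]
    ring

variable (A) in
/-- The coefficient of `t`, as a homomorphism `W_1(A) → A`. -/
def Wn.coeffOne : Wn A 1 →+ A :=
  MonoidHom.toAdditiveLeft
    (QuotientGroup.lift _ (coeffOneHom A) (by
      rintro ⟨u, hu⟩ h
      have h2 := PowerSeries.X_pow_dvd_iff.1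
        (mem_fil.1 (Subgroup.mem_subgroupOf.1 h)) 1 (by omega)
      rw [map_sub, sub_eq_zero] at h2
      have h3 : PowerSeries.coeff 1 (u : PowerSeries A) = 0 := by
        simpa [PowerSeries.coeff_one] using h2
      exact congrArg Multiplicative.ofAdd h3))

lemma Wn.coeffOne_mk (u : (PowerSeries A)ˣ) (hu : u ∈ fil A 0) :
    Wn.coeffOne A (Wn.mk 1 u hu) = PowerSeries.coeff 1 (u : PowerSeries A) :=
  rfl

lemma Wn.coeffOne_teichmuller (a : A) : Wn.coeffOne A (teichmuller 1 a) = a := by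
  rw [teichmuller, Wn.coeffOne_mk, coeff_teichUnit, pow_one]

lemma Wn.coeffOne_injective : Function.Injective (Wn.coeffOne A) := by
  rw [injective_iff_map_eq_zero]
  intro x h
  obtain ⟨u, hu, rfl⟩ := Wn.exists_mk x
  rw [Wn.coeffOne_mk] at h
  exact congrArg Additive.ofMul ((QuotientGroup.eq_one_iff _).2
    (Subgroup.mem_subgroupOf.2 (mem_fil_one hu h)))

variable (A) in
/-- The isomorphism `A ≃ W_1(A)`, `a ↦ [a]`, with inverse the coefficient of `t`. -/
def Wn.oneEquiv : A ≃+ Wn A 1 where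
  toFun a := teichmuller 1 a
  invFun := Wn.coeffOne A
  left_inv a := Wn.coeffOne_teichmuller a
  right_inv x := Wn.coeffOne_injective (Wn.coeffOne_teichmuller _)
  map_add' a b := Wn.coeffOne_injective (by
    rw [map_add, Wn.coeffOne_teichmuller, Wn.coeffOne_teichmuller, Wn.coeffOne_teichmuller])

lemma Wn.map_trunc {n k : ℕ} (h : k ≤ n) (g : A →+* B) (x : Wn A n) :
    Wn.trunc B h (Wn.map n g x) = Wn.map k g (Wn.trunc A h x) :=
  by obtain ⟨u, hu, rfl⟩ := Wn.exists_mk x; rfl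

lemma Wn.map_verschiebung (m : ℕ) (hm : m ≠ 0) (n : ℕ) (g : A →+* B) (x : Wn A n) :
    Wn.verschiebung B m hm n (Wn.map n g x) = Wn.map _ g (Wn.verschiebung A m hm n x) := by
  obtain ⟨u, hu, rfl⟩ := Wn.exists_mk x
  have : Units.map (PowerSeries.expand (R := B) m hm : PowerSeries B →* PowerSeries B)
        (Units.map (PowerSeries.map g : PowerSeries A →* PowerSeries B) u)
      = Units.map (PowerSeries.map g : PowerSeries A →* PowerSeries B)
        (Units.map (PowerSeries.expand (R := A) m hm : PowerSeries A →* PowerSeries A) u) := by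
    ext1
    exact (PowerSeries.map_expand m hm g u).symm
  simp only [Wn.map, Wn.verschiebung, Wn.lift_mk, this]

lemma Wn.coeffOne_map (g : A →+* B) (x : Wn A 1) :
    Wn.coeffOne B (Wn.map 1 g x) = g (Wn.coeffOne A x) :=
  by
  obtain ⟨u, hu, rfl⟩ := Wn.exists_mk x
  exact PowerSeries.coeff_map g 1 (u : PowerSeries A)

lemma Wn.map_oneEquiv (g : A →+* B) (a : A) :
    Wn.oneEquiv B (g a) = Wn.map 1 g (Wn.oneEquiv A a) :=
  Wn.coeffOne_injective (by
    rw [Wn.coeffOne_map]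
    exact (Wn.coeffOne_teichmuller _).trans (congrArg g (Wn.coeffOne_teichmuller a).symm))

lemma Wn.map_id (n : ℕ) (x : Wn A n) : Wn.map n (RingHom.id A) x = x := by
  obtain ⟨u, hu, rfl⟩ := Wn.exists_mk x
  have : Units.map (PowerSeries.map (RingHom.id A) : PowerSeries A →* PowerSeries A) u = u := by
    ext1
    simp
  simp only [Wn.map, Wn.lift_mk, this]

lemma Wn.map_comp {D : Type*} [CommRing D] (n : ℕ) (g : A →+* B) (h : B →+* D) (x : Wn A n) :
    Wn.map n (h.comp g) x = Wn.map n h (Wn.map n g x) := by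
  obtain ⟨u, hu, rfl⟩ := Wn.exists_mk x
  have : Units.map (PowerSeries.map (h.comp g) : PowerSeries A →* PowerSeries D) u
      = Units.map (PowerSeries.map h : PowerSeries B →* PowerSeries D)
        (Units.map (PowerSeries.map g : PowerSeries A →* PowerSeries B) u) := by
    ext1
    simp [PowerSeries.map_comp]
  simp only [Wn.map, Wn.lift_mk, this]

end Algebra

/-! ### The constructions as functors on commutative rings -/

/-- The functor sending a commutative ring to its additive group. -/
abbrev addGrp : CommRingCat.{u} ⥤ AddCommGrpCat.{u} :=
  forget₂ CommRingCat RingCat ⋙ forget₂ RingCat AddCommGrpCat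

/-- The functor `A ↦ W_n(A)`. -/
def wFunctor (n : ℕ) : CommRingCat.{u} ⥤ AddCommGrpCat.{u} where
  obj A := AddCommGrpCat.of (Wn A n)
  map g := AddCommGrpCat.ofHom (Wn.map n g.hom)
  map_id _ := AddCommGrpCat.hom_ext (AddMonoidHom.ext fun x => Wn.map_id n x)
  map_comp g h := AddCommGrpCat.hom_ext (AddMonoidHom.ext fun x => Wn.map_comp n g.hom h.hom x)

/-- Truncation as a natural transformation. -/
def truncNat {n k : ℕ} (h : k ≤ n) : wFunctor.{u} n ⟶ wFunctor k where
  app A := AddCommGrpCat.ofHom (Wn.trunc A h)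
  naturality _ _ g :=
    AddCommGrpCat.hom_ext (AddMonoidHom.ext fun x => Wn.map_trunc h g.hom x)

/-- Verschiebung as a natural transformation. -/
def verschiebungNat (m : ℕ) (hm : m ≠ 0) (n : ℕ) :
    wFunctor.{u} n ⟶ wFunctor (n * m + m - 1) where
  app A := AddCommGrpCat.ofHom (Wn.verschiebung A m hm n)
  naturality _ _ g :=
    AddCommGrpCat.hom_ext (AddMonoidHom.ext fun x => Wn.map_verschiebung m hm n g.hom x)

/-- The natural isomorphism `A ≃ W_1(A)`, `a ↦ [a]`. -/
def oneNatIso : addGrp.{u} ≅ wFunctor 1 :=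
  NatIso.ofComponents (fun A => (Wn.oneEquiv A).toAddCommGrpIso) (by
    intro A B g
    ext x
    exact Wn.map_oneEquiv g.hom x)

/-! ### Sheaves on a scheme -/

section Scheme

variable (X : Scheme.{u})

/-- Sheaves of abelian groups on a scheme, for the Zariski topology. -/
abbrev AbSheaf : Type _ := Sheaf (Opens.grothendieckTopology X) AddCommGrpCat.{u}

/-- The structure sheaf `O_X` as a sheaf of abelian groups. -/
def structureSheaf : AbSheaf X :=
  (sheafCompose (Opens.grothendieckTopology X) addGrp).obj X.sheaf

/-- The presheaf `U ↦ W_n(O_X(U))`. -/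
def wittPresheaf (n : ℕ) : (Opens X)ᵒᵖ ⥤ AddCommGrpCat.{u} :=
  X.presheaf ⋙ wFunctor n

/-- The sheaf `W_n O_X` of generalized Witt vectors of length `n`: the sheaf associated with
`U ↦ W_n(O_X(U))`. -/
def wittSheaf (n : ℕ) : AbSheaf X :=
  (presheafToSheaf (Opens.grothendieckTopology X) AddCommGrpCat.{u}).obj (wittPresheaf X n)

/-- The truncation `W_n O_X → W_k O_X` on the level of presheaves. -/
def presheafTrunc {n k : ℕ} (h : k ≤ n) : wittPresheaf X n ⟶ wittPresheaf X k :=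
  Functor.whiskerLeft X.presheaf (truncNat h)

/-- The Verschiebung on the level of presheaves. -/
def presheafVerschiebung (m : ℕ) (hm : m ≠ 0) (n : ℕ) :
    wittPresheaf X n ⟶ wittPresheaf X (n * m + m - 1) :=
  Functor.whiskerLeft X.presheaf (verschiebungNat m hm n)

/-- The identification `a ↦ [a]` on the level of presheaves. -/
def structurePresheafIso : (structureSheaf X).obj ≅ wittPresheaf X 1 :=
  Functor.isoWhiskerLeft X.presheaf oneNatIso

/-- The truncation `W_n O_X → W_k O_X` for `k ≤ n`. -/
def wittTrunc {n k : ℕ} (h : k ≤ n) : wittSheaf X n ⟶ wittSheaf X k :=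
  (presheafToSheaf _ _).map (presheafTrunc X h)

/-- The Verschiebung `V_m : W_n O_X → W_{nm+m-1} O_X`. -/
def wittVerschiebung (m : ℕ) (hm : m ≠ 0) (n : ℕ) :
    wittSheaf X n ⟶ wittSheaf X (n * m + m - 1) :=
  (presheafToSheaf _ _).map (presheafVerschiebung X m hm n)

/-- The identification `O_X ≅ W_1 O_X`, `a ↦ [a]`. -/
def structureSheafIso : structureSheaf X ≅ wittSheaf X 1 :=
  sheafificationIso (structureSheaf X) ≪≫
    (presheafToSheaf _ _).mapIso (structurePresheafIso X)

/-- The map `O_X = W_1 O_X → W_{2N-1} O_X → W_N O_X`: the Verschiebung `V_N` followed by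
truncation. -/
def verschiebungO (N : ℕ) (hN : N ≠ 0) : structureSheaf X ⟶ wittSheaf X N :=
  (structureSheafIso X).hom ≫ wittVerschiebung X N hN 1 ≫
    wittTrunc X (show N ≤ 1 * N + N - 1 by omega)

/-- The truncation `W_N O_X → W_1 O_X = O_X`. -/
def truncO (N : ℕ) (hN : 1 ≤ N) : wittSheaf X N ⟶ structureSheaf X :=
  wittTrunc X hN ≫ (structureSheafIso X).inv

/-! ### Multiplication by functions and the module structure on cohomology -/

variable {X}

/-- The restriction of a global function to an open subset. -/
def restr (U : (Opens X)ᵒᵖ) : Γ(X, ⊤) →+* X.presheaf.obj U :=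
  (X.presheaf.map (homOfLE le_top : U.unop ⟶ ⊤).op).hom

lemma map_restr {U V : (Opens X)ᵒᵖ} (i : U ⟶ V) (s : Γ(X, ⊤)) :
    X.presheaf.map i (restr U s) = restr V s := by
  rw [restr, restr, ← CommRingCat.comp_apply, ← Functor.map_comp]
  rfl

/-- Multiplication by a global function `s`, as an endomorphism of the abelian sheaf `O_X`:
on an open `U` it is multiplication by the restriction of `s` to `U`. -/
def mulEnd (s : Γ(X, ⊤)) : structureSheaf X ⟶ structureSheaf X :=
  ⟨{ app := fun U => AddCommGrpCat.ofHom
      (AddMonoidHom.mulLeft (restr U s))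
     naturality := fun U _ i => AddCommGrpCat.hom_ext (AddMonoidHom.ext
      fun (x : X.presheaf.obj U) =>
        (((X.presheaf.map i).hom.map_mul (restr U s) x).trans
          (congrArg (· * X.presheaf.map i x) (map_restr i s))).symm) }⟩

lemma mulEnd_ext {g h : structureSheaf X ⟶ structureSheaf X}
    (e : ∀ (U : (Opens X)ᵒᵖ) (y : X.presheaf.obj U),
      (g.hom.app U).hom y = (h.hom.app U).hom y) : g = h := by
  ext U y
  exact e U y

lemma mulEnd_one : mulEnd (1 : Γ(X, ⊤)) = 𝟙 _ :=
  mulEnd_ext fun U y =>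
    (congrArg (· * y) (map_one (restr U))).trans (one_mul (M := X.presheaf.obj U) y)

lemma mulEnd_zero : mulEnd (0 : Γ(X, ⊤)) = 0 :=
  mulEnd_ext fun U y =>
    (congrArg (· * y) (map_zero (restr U))).trans (zero_mul (M₀ := X.presheaf.obj U) y)

lemma mulEnd_add (s t : Γ(X, ⊤)) : mulEnd (s + t) = mulEnd s + mulEnd t :=
  mulEnd_ext fun U y =>
    (congrArg (· * y) (map_add (restr U) s t)).trans (add_mul (restr U s) (restr U t) y)

lemma mulEnd_mul (s t : Γ(X, ⊤)) : mulEnd (s * t) = mulEnd t ≫ mulEnd s :=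
  mulEnd_ext fun U y =>
    (congrArg (· * y) (map_mul (restr U) s t)).trans (mul_assoc (restr U s) (restr U t) y)

variable {A : Type u} [CommRing A]

/-- The function on `X` defined by an element of `A`, for a scheme `X` over `Spec A`. -/
def functionOf (f : X ⟶ Spec (CommRingCat.of A)) : A →+* Γ(X, ⊤) :=
  ((Scheme.ΓSpecIso (CommRingCat.of A)).inv ≫ f.appTop).hom

/-- `A` acts on `H^j(X, O_X)` through its action on `O_X` by multiplication. -/
@[reducible] def cohomologyModule (f : X ⟶ Spec (CommRingCat.of A)) (j : ℕ) :
    Module A (Sheaf.H (structureSheaf X) j) where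
  smul a x := Sheaf.H.map (mulEnd (functionOf f a)) j x
  one_smul x := by
    change Sheaf.H.map (mulEnd (functionOf f 1)) j x = x
    rw [map_one, mulEnd_one, Sheaf.H.map_id_apply]
  mul_smul a b x := by
    change Sheaf.H.map (mulEnd (functionOf f (a * b))) j x
      = Sheaf.H.map (mulEnd (functionOf f a)) j (Sheaf.H.map (mulEnd (functionOf f b)) j x)
    rw [map_mul, mulEnd_mul, Sheaf.H.map_comp_apply]
  smul_zero a := map_zero (Sheaf.H.map (mulEnd (functionOf f a)) j)
  smul_add a := map_add (Sheaf.H.map (mulEnd (functionOf f a)) j)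
  add_smul a b x := by
    change Sheaf.H.map (mulEnd (functionOf f (a + b))) j x
      = Sheaf.H.map (mulEnd (functionOf f a)) j x + Sheaf.H.map (mulEnd (functionOf f b)) j x
    rw [map_add, mulEnd_add, Sheaf.H.map_add_apply]
  zero_smul x := by
    change Sheaf.H.map (mulEnd (functionOf f 0)) j x = 0
    have h := Sheaf.H.map_add_apply (0 : structureSheaf X ⟶ structureSheaf X) 0 x
    rw [add_zero] at h
    rw [map_zero, mulEnd_zero]
    exact left_eq_add.1 h

/-- The cohomology `H^j(X, O_X)` of a scheme `X` over `Spec A`, as an `A`-module. -/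
def HO (_f : X ⟶ Spec (CommRingCat.of A)) (j : ℕ) : Type u :=
  Sheaf.H (structureSheaf X) j

instance (f : X ⟶ Spec (CommRingCat.of A)) (j : ℕ) : AddCommGroup (HO f j) :=
  inferInstanceAs (AddCommGroup (Sheaf.H (structureSheaf X) j))

instance (f : X ⟶ Spec (CommRingCat.of A)) (j : ℕ) : Module A (HO f j) :=
  cohomologyModule f j

end Scheme

end GenWitt

end

/-! On every open set, the kernel of W_N → W_{N-1} consists of the classes of 1/(1 - a t^N), a copy
of the structure ring embedded by V_N. Sheafification is exact, so 0 → O_X → W_N O_X → W_{N-1} O_X →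
0 is a short exact sequence of abelian sheaves (`wittComplex_shortExact`).

The point is that V_N stays injective on cohomology. The N-th ghost component, the coefficient of
t^N in t u'/u, is a natural additive map W_N O_X → O_X, and its composite with V_N is multiplication
by N (`verschiebungO_comp_ghostO`). Each H^j(X, O_X) is free over A and A is flat over ℤ, so
multiplication by N is injective there, and hence so is H^j(V_N).

In the long exact sequence, the image of the connecting map H^j(W_{N-1} O_X) → H^{j+1}(O_X) is
killed by the injective map H^{j+1}(V_N), so the connecting map is zero and the long sequence breaks
into short exact ones (`H_map_exact_and_surjective`). Surjectivity onto H^j(O_X) follows by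
composing the one-step truncations down to W_1. -/

noncomputable section

namespace GenWitt

/-! ### Ghost components and the sequence A → W_n(A) → W_{n-1}(A). -/

section Algebra

variable {A B : Type*} [CommRing A] [CommRing B]

open PowerSeries in
/-- The logarithmic derivative `u ↦ u' / u` on the units of `A[[t]]`. -/
def logDeriv (A : Type*) [CommRing A] : (PowerSeries A)ˣ →* Multiplicative (PowerSeries A) where
  toFun u := Multiplicative.ofAdd (((u⁻¹ : (PowerSeries A)ˣ) : PowerSeries A) * derivative A u)
  map_one' := by simp
  map_mul' u v := by
    rw [← ofAdd_add]
    congr 1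
    simp only [mul_inv, Units.val_mul, Derivation.leibniz, smul_eq_mul]
    linear_combination (((v⁻¹ : (PowerSeries A)ˣ) : PowerSeries A) * derivative A v) * u.inv_mul +
      (((u⁻¹ : (PowerSeries A)ˣ) : PowerSeries A) * derivative A u) * v.inv_mul

/-- The coefficient of `t^(n-1)` in the logarithmic derivative. -/
def ghostHom (A : Type*) [CommRing A] (n : ℕ) : (PowerSeries A)ˣ →* Multiplicative A :=
  (AddMonoidHom.toMultiplicative (PowerSeries.coeff (R := A) (n - 1)).toAddMonoidHom).comp
    (logDeriv A)

lemma ghostHom_apply (n : ℕ) (u : (PowerSeries A)ˣ) :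
    (ghostHom A n u).toAdd = PowerSeries.coeff (n - 1)
      (((u⁻¹ : (PowerSeries A)ˣ) : PowerSeries A) * PowerSeries.derivative A u) :=
  rfl

/-- If u = 1 + t^(n+1) w, then t^n divides u', so the coefficient of t^(n-1) in u'/u vanishes. This
is what lets the ghost component descend to W_n. -/
lemma ghostHom_eq_one {n : ℕ} (hn : n ≠ 0) {u : (PowerSeries A)ˣ} (hu : u ∈ fil A n) :
    ghostHom A n u = 1 := by
  change (ghostHom A n u).toAdd = 0
  obtain ⟨w, hw⟩ := mem_fil.1 hu
  rw [ghostHom_apply, eq_add_of_sub_eq hw, map_add, PowerSeries.derivative_one, add_zero,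
    Derivation.leibniz, PowerSeries.derivative_pow, PowerSeries.derivative_X]
  refine (PowerSeries.X_pow_dvd_iff (n := n)).1 ?_ _ (by omega)
  simp only [Nat.add_sub_cancel, smul_eq_mul]
  refine Dvd.dvd.mul_left (dvd_add ?_ ?_) _
  · exact (pow_dvd_pow _ (by omega)).mul_right _
  · exact Dvd.dvd.mul_left ((Dvd.intro_left _ rfl).mul_right _) _

/-- The `n`-th ghost component `W_n(A) → A`: the coefficient of `t^n` in `t u' / u`. -/
def Wn.ghost (A : Type*) [CommRing A] (n : ℕ) (hn : n ≠ 0) : Wn A n →+ A :=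
  MonoidHom.toAdditiveLeft
    (QuotientGroup.lift _ ((ghostHom A n).comp (fil A 0).subtype)
      (fun _ h => ghostHom_eq_one hn (Subgroup.mem_subgroupOf.1 h)))

lemma Wn.ghost_mk (n : ℕ) (hn : n ≠ 0) (u : (PowerSeries A)ˣ) (hu : u ∈ fil A 0) :
    Wn.ghost A n hn (Wn.mk n u hu) = (ghostHom A n u).toAdd :=
  rfl

lemma derivative_map (g : A →+* B) (p : PowerSeries A) :
    PowerSeries.derivative B (PowerSeries.map g p) =
      PowerSeries.map g (PowerSeries.derivative A p) := by
  ext n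
  simp [PowerSeries.coeff_derivative]

lemma Wn.ghost_map (n : ℕ) (hn : n ≠ 0) (g : A →+* B) (x : Wn A n) :
    Wn.ghost B n hn (Wn.map n g x) = g (Wn.ghost A n hn x) := by
  obtain ⟨u, hu, rfl⟩ := Wn.exists_mk x
  rw [Wn.map, Wn.lift_mk, Wn.ghost_mk, Wn.ghost_mk, ghostHom_apply, ghostHom_apply,
    ← PowerSeries.coeff_map, map_mul (PowerSeries.map g), ← derivative_map, ← map_inv]
  rfl

/-- The power series `1 / (1 - a t^n)`, as a unit. -/
def expandTeich (n : ℕ) (hn : n ≠ 0) (a : A) : (PowerSeries A)ˣ :=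
  Units.map (PowerSeries.expand (R := A) n hn : PowerSeries A →* PowerSeries A) (teichUnit a)

variable (A) in
/-- The map `A ≃ W_1(A) → W_{2n-1}(A) → W_n(A)`. -/
def Wn.verschiebungOne (n : ℕ) (hn : n ≠ 0) : A →+ Wn A n :=
  (Wn.trunc A (show n ≤ 1 * n + n - 1 by omega)).comp
    ((Wn.verschiebung A n hn 1).comp (Wn.oneEquiv A).toAddMonoidHom)

lemma expandTeich_mem (n : ℕ) (hn : n ≠ 0) (a : A) : expandTeich n hn a ∈ fil A 0 :=
  expand_mem_fil hn (by omega) (teichUnit_mem a)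

lemma Wn.verschiebungOne_apply (n : ℕ) (hn : n ≠ 0) (a : A) :
    Wn.verschiebungOne A n hn a = Wn.mk n (expandTeich n hn a) (expandTeich_mem n hn a) :=
  rfl

lemma coe_expandTeich_inv (n : ℕ) (hn : n ≠ 0) (a : A) :
    (((expandTeich n hn a)⁻¹ : (PowerSeries A)ˣ) : PowerSeries A) =
      1 - PowerSeries.C a * PowerSeries.X ^ n := by
  rw [expandTeich, ← map_inv, teichUnit, inv_inv]
  change PowerSeries.expand n hn (1 - PowerSeries.C a * PowerSeries.X) = _
  rw [map_sub, map_mul, map_one, PowerSeries.expand_C, PowerSeries.expand_X]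

lemma coeff_expandTeich (n : ℕ) (hn : n ≠ 0) (a : A) :
    PowerSeries.coeff n (expandTeich n hn a : PowerSeries A) = a := by
  have h := PowerSeries.coeff_expand_mul n hn (teichUnit a : PowerSeries A) 1
  rw [mul_one, coeff_teichUnit, pow_one] at h
  exact h

lemma X_pow_dvd_expandTeich_sub_one (n : ℕ) (hn : n ≠ 0) (a : A) :
    (PowerSeries.X : PowerSeries A) ^ n ∣ (expandTeich n hn a : PowerSeries A) - 1 := by
  -- Membership in `fil A k` means divisibility by `X ^ (k + 1)`, so the exponent n corresponds to k
  -- = n - 1.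
  obtain ⟨k, rfl⟩ := Nat.exists_eq_succ_of_ne_zero hn
  exact mem_fil.1 (expand_mem_fil hn (by omega) (teichUnit_mem a))

lemma Wn.ghost_verschiebungOne (n : ℕ) (hn : n ≠ 0) (a : A) :
    Wn.ghost A n hn (Wn.verschiebungOne A n hn a) = n • a := by
  -- Negating both sides replaces the series by its inverse, the polynomial 1 - a t^n, whose
  -- derivative is explicit.
  rw [Wn.verschiebungOne_apply, Wn.ghost_mk, ← neg_inj, ← toAdd_inv, ← map_inv, ghostHom_apply,
    inv_inv, coe_expandTeich_inv, map_sub, PowerSeries.derivative_one, Derivation.leibniz,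
    PowerSeries.derivative_C, PowerSeries.derivative_pow, PowerSeries.derivative_X]
  have h : (expandTeich n hn a : PowerSeries A) *
      (0 - (PowerSeries.C a • ((n : PowerSeries A) * PowerSeries.X ^ (n - 1) * 1) +
        (PowerSeries.X : PowerSeries A) ^ n • (0 : PowerSeries A))) =
      -(PowerSeries.X ^ (n - 1) * (n • (PowerSeries.C a * (expandTeich n hn a : PowerSeries A)))) := by
    simp only [smul_eq_mul, nsmul_eq_mul]
    ring
  have h0 := coeff_zero_of_mem (expandTeich_mem n hn a)
  rw [h, map_neg, PowerSeries.coeff_X_pow_mul', if_pos le_rfl, Nat.sub_self, map_nsmul,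
    PowerSeries.coeff_C_mul, h0, mul_one]

lemma Wn.mk_eq_zero_iff {n : ℕ} {u : (PowerSeries A)ˣ} {hu : u ∈ fil A 0} :
    Wn.mk n u hu = 0 ↔ u ∈ fil A n :=
  ((QuotientGroup.eq_one_iff (N := (fil A n).subgroupOf (fil A 0)) ⟨u, hu⟩)).trans
    Subgroup.mem_subgroupOf

/-- The coefficient of t^n in 1/(1 - a t^n) is a, and it is visible modulo t^(n+1). -/
lemma Wn.verschiebungOne_injective (n : ℕ) (hn : n ≠ 0) :
    Function.Injective (Wn.verschiebungOne A n hn) := by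
  rw [injective_iff_map_eq_zero]
  intro a ha
  rw [Wn.verschiebungOne_apply, Wn.mk_eq_zero_iff, mem_fil, PowerSeries.X_pow_dvd_iff] at ha
  have h := ha n (by omega)
  rwa [map_sub, coeff_expandTeich, PowerSeries.coeff_one, if_neg hn, sub_zero] at h

lemma Wn.trunc_surjective {n k : ℕ} (h : k ≤ n) : Function.Surjective (Wn.trunc A h) := by
  intro x
  obtain ⟨u, hu, rfl⟩ := Wn.exists_mk x
  exact ⟨Wn.mk n u hu, rfl⟩

lemma Wn.trunc_trunc {n k l : ℕ} (h : k ≤ n) (h' : l ≤ k) (x : Wn A n) :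
    Wn.trunc A h' (Wn.trunc A h x) = Wn.trunc A (h'.trans h) x := by
  obtain ⟨u, hu, rfl⟩ := Wn.exists_mk x
  simp only [Wn.trunc, Wn.lift_mk, MonoidHom.id_apply]

lemma Wn.trunc_refl {n : ℕ} (x : Wn A n) : Wn.trunc A (le_refl n) x = x := by
  obtain ⟨u, hu, rfl⟩ := Wn.exists_mk x
  simp only [Wn.trunc, Wn.lift_mk, MonoidHom.id_apply]

lemma Wn.exact_verschiebungOne_trunc (n : ℕ) (hn : n ≠ 0) :
    Function.Exact (Wn.verschiebungOne A n hn) (Wn.trunc A (Nat.sub_le n 1)) := by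
  intro x
  obtain ⟨u, hu, rfl⟩ := Wn.exists_mk x
  change Wn.mk (n - 1) u hu = 0 ↔ _
  rw [Wn.mk_eq_zero_iff]
  constructor
  · intro h
    -- Both u and 1/(1 - a t^n) are 1 modulo t^n; choosing a as the t^n-coefficient of u makes them
    -- agree modulo t^(n+1).
    refine ⟨PowerSeries.coeff n (u : PowerSeries A), ?_⟩
    set e := expandTeich n hn (PowerSeries.coeff n (u : PowerSeries A)) with he
    have hd : (PowerSeries.X : PowerSeries A) ^ (n + 1) ∣ (e : PowerSeries A) - u := by
      have h1 := X_pow_dvd_expandTeich_sub_one n hn (PowerSeries.coeff n (u : PowerSeries A))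
      have h2 : (PowerSeries.X : PowerSeries A) ^ n ∣ (u : PowerSeries A) - 1 := by
        simpa [mem_fil, Nat.sub_add_cancel (Nat.one_le_iff_ne_zero.2 hn)] using h
      have h3 := dvd_sub h1 h2
      rw [sub_sub_sub_cancel_right] at h3
      rw [PowerSeries.X_pow_dvd_iff] at h3 ⊢
      intro m hm
      rcases Nat.lt_succ_iff_lt_or_eq.1 hm with hm | rfl
      · exact h3 m hm
      · rw [map_sub, he, coeff_expandTeich, sub_self]
    rw [Wn.verschiebungOne_apply, ← sub_eq_zero]
    refine (Wn.mk_eq_zero_iff (u := e / u)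
      (hu := (fil A 0).div_mem (expandTeich_mem n hn _) hu)).2 ?_
    rw [mem_fil, div_eq_mul_inv]
    have h4 : ((e * u⁻¹ : (PowerSeries A)ˣ) : PowerSeries A) - 1 =
        (e - u) * ((u⁻¹ : (PowerSeries A)ˣ) : PowerSeries A) := by
      rw [sub_mul, Units.mul_inv, Units.val_mul]
    rw [h4]
    exact hd.mul_right _
  · rintro ⟨a, ha⟩
    have h := congrArg (Wn.trunc A (Nat.sub_le n 1)) ha
    change Wn.mk (n - 1) (expandTeich n hn a) (expandTeich_mem n hn a) = Wn.mk (n - 1) u hu at h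
    rw [← Wn.mk_eq_zero_iff (hu := hu), ← h, Wn.mk_eq_zero_iff, mem_fil,
      Nat.sub_add_cancel (Nat.one_le_iff_ne_zero.2 hn)]
    exact X_pow_dvd_expandTeich_sub_one n hn a

end Algebra

/-! ### Short exactness in functor categories. -/

section FunctorCategory

open Limits

variable {T V : Type*} [Category* T] [Category* V] [Abelian V]

/-- Evaluation functors are exact, so they commute with homology, and a functor is zero when all its
values are. -/
lemma shortExact_of_evaluation (S : ShortComplex (T ⥤ V))
    (h : ∀ t, (S.map ((evaluation T V).obj t)).ShortExact) : S.ShortExact where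
  exact := by
    rw [ShortComplex.exact_iff_isZero_homology, Functor.isZero_iff]
    intro t
    exact ((ShortComplex.exact_iff_isZero_homology _).1 (h t).exact).of_iso
      (S.mapHomologyIso ((evaluation T V).obj t)).symm
  mono_f := by
    rw [NatTrans.mono_iff_mono_app]
    exact fun t => (h t).mono_f
  epi_g := by
    rw [NatTrans.epi_iff_epi_app]
    exact fun t => (h t).epi_g

end FunctorCategory

/-! ### Cohomology of abelian sheaves and the long exact sequence. -/

section Cohomology

variable {C : Type*} [Category* C] {J : GrothendieckTopology C}
  [HasSheafify J AddCommGrpCat.{u}] [HasExt.{u} (Sheaf J AddCommGrpCat.{u})]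

variable (F G : Sheaf J AddCommGrpCat.{u}) in
/-- The action of morphisms of sheaves on cohomology, as a biadditive map. -/
def homMapHom (j : ℕ) : (F ⟶ G) →+ Sheaf.H F j →+ Sheaf.H G j :=
  AddMonoidHom.mk' (fun f => Sheaf.H.map f j) fun f g =>
    AddMonoidHom.ext fun x => Sheaf.H.map_add_apply f g x

lemma homMapHom_apply {F G : Sheaf J AddCommGrpCat.{u}} (j : ℕ) (f : F ⟶ G) :
    homMapHom F G j f = Sheaf.H.map f j :=
  rfl

/-- If the composite of `f : F ⟶ G` with some `r : G ⟶ F` is multiplication by a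
nonzero integer and the cohomology of `F` is torsion free, then `f` is injective on cohomology. -/
lemma H_map_injective_of_comp_eq_nsmul {F G : Sheaf J AddCommGrpCat.{u}} (f : F ⟶ G) (r : G ⟶ F)
    {n : ℕ} (hr : f ≫ r = n • 𝟙 F) {j : ℕ}
    (hn : Function.Injective fun x : Sheaf.H F j => n • x) :
    Function.Injective (Sheaf.H.map f j) := by
  -- Additivity of the action in the morphism variable shows that `n • 𝟙 F` acts as multiplication
  -- by n.
  have h (x : Sheaf.H F j) : Sheaf.H.map r j (Sheaf.H.map f j x) = n • x := by
    rw [← Sheaf.H.map_comp_apply, hr]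
    have := map_nsmul ((homMapHom F F j).flip x) n (𝟙 F)
    simpa only [AddMonoidHom.flip_apply, homMapHom_apply, Sheaf.H.map_id_apply] using this
  intro x y hxy
  apply hn
  change n • x = n • y
  rw [← h, ← h, hxy]

/-- A short exact sequence of abelian sheaves whose first map is injective on cohomology induces
short exact sequences on cohomology. -/
lemma H_map_exact_and_surjective {S : ShortComplex (Sheaf J AddCommGrpCat.{u})} (hS : S.ShortExact)
    (j : ℕ) (hinj : Function.Injective (Sheaf.H.map S.f (j + 1))) :
    Function.Exact (Sheaf.H.map S.f j) (Sheaf.H.map S.g j) ∧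
      Function.Surjective (Sheaf.H.map S.g j) := by
  refine ⟨fun x => ⟨fun hx => Abelian.Ext.covariant_sequence_exact₂ _ hS x hx, ?_⟩, fun x =>
    Abelian.Ext.covariant_sequence_exact₃ _ hS x rfl (hinj ?_)⟩
  · rintro ⟨y, rfl⟩
    rw [← Sheaf.H.map_comp_apply, S.zero]
    exact map_zero ((homMapHom S.X₁ S.X₃ j).flip y)
  -- The boundary of x maps to zero under `S.f` in degree j + 1; by `hinj` it is itself zero, so x
  -- lifts.
  · rw [map_zero, Sheaf.H.map_apply, Abelian.Ext.comp_assoc_of_third_deg_zero,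
      hS.extClass_comp, Abelian.Ext.comp_zero]

end Cohomology

/-- Used with L the sheafification functor, to reduce a composite of sheaf maps to a composite of
presheaf maps. -/
lemma comp_map_comp_map_comp {C D : Type*} [Category* C] [Category* D] (L : C ⥤ D) {Y Z : D}
    {a b c : C} (p : Y ⟶ L.obj a) (f : a ⟶ b) (g : b ⟶ c) (q : L.obj c ⟶ Z) :
    (p ≫ L.map f) ≫ L.map g ≫ q = p ≫ L.map (f ≫ g) ≫ q := by
  simp

lemma map_comp_comp {C D : Type*} [Category* C] [Category* D] (L : C ⥤ D) {a b c d : C}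
    (f : a ⟶ b) (g : b ⟶ c) (h : c ⟶ d) : L.map (f ≫ g ≫ h) = L.map f ≫ L.map g ≫ L.map h := by
  simp

/-! ### Verschiebung, truncation and ghost component as natural transformations on rings. -/

section Functors

/-- The truncation maps are compatible. -/
lemma truncNat_comp {n k l : ℕ} (h : k ≤ n) (h' : l ≤ k) :
    truncNat.{u} h ≫ truncNat h' = truncNat (h'.trans h) := by
  refine NatTrans.ext (funext fun R => AddCommGrpCat.hom_ext (AddMonoidHom.ext fun x => ?_))
  rw [NatTrans.comp_app, AddCommGrpCat.hom_comp]
  exact (AddMonoidHom.comp_apply _ _ _).trans (Wn.trunc_trunc h h' x)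

lemma truncNat_refl (n : ℕ) : truncNat.{u} (le_refl n) = 𝟙 _ :=
  NatTrans.ext (funext fun _ => AddCommGrpCat.hom_ext (AddMonoidHom.ext Wn.trunc_refl))

/-- The map `A = W_1(A) → W_{2N-1}(A) → W_N(A)` as a natural transformation. -/
def verschiebungOneNat (N : ℕ) (hN : N ≠ 0) : addGrp.{u} ⟶ wFunctor N :=
  oneNatIso.hom ≫ verschiebungNat N hN 1 ≫ truncNat (show N ≤ 1 * N + N - 1 by omega)

lemma verschiebungOneNat_app_apply (N : ℕ) (hN : N ≠ 0) (R : CommRingCat.{u}) (x : R) :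
    ((verschiebungOneNat N hN).app R).hom x = Wn.verschiebungOne R N hN x := by
  rw [verschiebungOneNat, NatTrans.comp_app, NatTrans.comp_app, AddCommGrpCat.hom_comp,
    AddCommGrpCat.hom_comp]
  exact (AddMonoidHom.comp_apply _ _ _).trans (AddMonoidHom.comp_apply _ _ _)

/-- The `N`-th ghost component as a natural transformation. -/
def ghostNat (N : ℕ) (hN : N ≠ 0) : wFunctor.{u} N ⟶ addGrp where
  app A := AddCommGrpCat.ofHom (Wn.ghost A N hN)
  naturality _ _ g := AddCommGrpCat.hom_ext (AddMonoidHom.ext fun x => Wn.ghost_map N hN g.hom x)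

lemma verschiebungOneNat_comp_ghostNat (N : ℕ) (hN : N ≠ 0) :
    verschiebungOneNat.{u} N hN ≫ ghostNat N hN = N • 𝟙 addGrp := by
  refine NatTrans.ext (funext fun R => AddCommGrpCat.hom_ext (AddMonoidHom.ext fun (x : R) => ?_))
  rw [NatTrans.comp_app, AddCommGrpCat.hom_comp, NatTrans.app_nsmul, NatTrans.id_app,
    AddCommGrpCat.hom_nsmul, AddCommGrpCat.hom_id]
  refine (AddMonoidHom.comp_apply _ _ _).trans ?_
  refine (congrArg (Wn.ghost R N hN) (verschiebungOneNat_app_apply N hN R x)).trans ?_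
  exact (Wn.ghost_verschiebungOne (A := R) N hN x).trans
    (AddMonoidHom.nsmul_apply (AddMonoidHom.id (addGrp.obj R)) N x).symm

lemma verschiebungOneNat_injective (N : ℕ) (hN : N ≠ 0) (R : CommRingCat.{u}) :
    Function.Injective ((verschiebungOneNat N hN).app R).hom :=
  fun (x y : R) h => Wn.verschiebungOne_injective (A := R) N hN
    ((verschiebungOneNat_app_apply N hN R x).symm.trans
      (h.trans (verschiebungOneNat_app_apply N hN R y)))

lemma exact_verschiebungOneNat_truncNat (N : ℕ) (hN : N ≠ 0) (R : CommRingCat.{u}) :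
    Function.Exact ((verschiebungOneNat N hN).app R).hom
      ((truncNat (Nat.sub_le N 1)).app R).hom :=
  fun (x : Wn R N) => (Wn.exact_verschiebungOne_trunc (A := R) N hN x).trans
    (exists_congr fun y : R => by rw [← verschiebungOneNat_app_apply]; exact Iff.rfl)

/-- The complex `R → W_N(R) → W_{N-1}(R)`, functorially in `R`. -/
def functorComplex (N : ℕ) (hN : N ≠ 0) : ShortComplex (CommRingCat.{u} ⥤ AddCommGrpCat.{u}) :=
  ShortComplex.mk (verschiebungOneNat N hN) (truncNat (Nat.sub_le N 1)) (by
    refine NatTrans.ext (funext fun R => AddCommGrpCat.hom_ext (AddMonoidHom.ext fun x => ?_))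
    rw [NatTrans.comp_app, AddCommGrpCat.hom_comp]
    exact (exact_verschiebungOneNat_truncNat N hN R).apply_apply_eq_zero x)

lemma functorComplex_evaluation_shortExact (N : ℕ) (hN : N ≠ 0) (R : CommRingCat.{u}) :
    ((functorComplex N hN).map ((evaluation _ _).obj R)).ShortExact where
  exact := (ShortComplex.ab_exact_iff_function_exact _).2
    (exact_verschiebungOneNat_truncNat N hN R)
  mono_f := (AddCommGrpCat.mono_iff_injective ((verschiebungOneNat N hN).app R)).2
    (verschiebungOneNat_injective N hN R)
  epi_g := (AddCommGrpCat.epi_iff_surjective ((truncNat (Nat.sub_le N 1)).app R)).2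
    (Wn.trunc_surjective (Nat.sub_le N 1))

end Functors

/-! ### Passage to sheaves on X and to their cohomology. -/

section Scheme

variable (X : Scheme.{u})

/-- The map `O_X → W_N O_X` given by the Verschiebung, on the level of presheaves. -/
def presheafVerschiebungO (N : ℕ) (hN : N ≠ 0) : (structureSheaf X).obj ⟶ wittPresheaf X N :=
  Functor.whiskerLeft X.presheaf (verschiebungOneNat N hN)

/-- The `N`-th ghost component on the level of presheaves. -/
def presheafGhost (N : ℕ) (hN : N ≠ 0) : wittPresheaf X N ⟶ (structureSheaf X).obj :=
  Functor.whiskerLeft X.presheaf (ghostNat N hN)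

lemma presheafVerschiebungO_comp_presheafGhost (N : ℕ) (hN : N ≠ 0) :
    presheafVerschiebungO X N hN ≫ presheafGhost X N hN = N • 𝟙 (structureSheaf X).obj :=
  (Functor.whiskerLeft_comp X.presheaf (verschiebungOneNat N hN) (ghostNat N hN)).symm.trans
    ((congrArg (Functor.whiskerLeft X.presheaf) (verschiebungOneNat_comp_ghostNat N hN)).trans
      (((Functor.whiskeringLeft _ _ _).obj X.presheaf).map_nsmul (f := 𝟙 addGrp)))

/-- The complex `O_X → W_N O_X → W_{N-1} O_X` of presheaves. -/
def presheafComplex (N : ℕ) (hN : N ≠ 0) : ShortComplex ((Opens X)ᵒᵖ ⥤ AddCommGrpCat.{u}) :=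
  (functorComplex N hN).map ((Functor.whiskeringLeft _ _ _).obj X.presheaf)

lemma presheafComplex_shortExact (N : ℕ) (hN : N ≠ 0) : (presheafComplex X N hN).ShortExact :=
  shortExact_of_evaluation _ fun U => functorComplex_evaluation_shortExact N hN (X.presheaf.obj U)

/-- Identifies the sheaf map with the sheafified presheaf map, up to O_X being its own
sheafification, so that presheaf statements can be transported. -/
lemma verschiebungO_eq (N : ℕ) (hN : N ≠ 0) :
    verschiebungO X N hN = (sheafificationIso (structureSheaf X)).hom ≫
      (presheafToSheaf _ _).map (presheafVerschiebungO X N hN) := by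
  refine (Category.assoc _ _ _).trans (congrArg _ ?_)
  rw [presheafVerschiebungO, verschiebungOneNat, Functor.whiskerLeft_comp,
    Functor.whiskerLeft_comp]
  exact (map_comp_comp (presheafToSheaf _ _) _ _ _).symm

/-- The `N`-th ghost component `W_N O_X → O_X`. -/
def ghostO (N : ℕ) (hN : N ≠ 0) : wittSheaf X N ⟶ structureSheaf X :=
  (presheafToSheaf _ _).map (presheafGhost X N hN) ≫ (sheafificationIso (structureSheaf X)).inv

lemma verschiebungO_comp_ghostO (N : ℕ) (hN : N ≠ 0) :
    verschiebungO X N hN ≫ ghostO X N hN = N • 𝟙 (structureSheaf X) := by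
  rw [verschiebungO_eq]
  refine (comp_map_comp_map_comp _ _ _ _ _).trans ?_
  rw [presheafVerschiebungO_comp_presheafGhost, Functor.map_nsmul,
    CategoryTheory.Functor.map_id, Preadditive.nsmul_comp, Preadditive.comp_nsmul,
    Category.id_comp, Iso.hom_inv_id]

/-- The complex `O_X → W_N O_X → W_{N-1} O_X` of abelian sheaves. -/
def wittComplex (N : ℕ) (hN : N ≠ 0) : ShortComplex (AbSheaf X) :=
  ShortComplex.mk (verschiebungO X N hN) (wittTrunc X (Nat.sub_le N 1)) (by
    rw [verschiebungO_eq]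
    refine (Category.assoc _ _ _).trans ?_
    refine (congrArg _ ((presheafComplex X N hN).map (presheafToSheaf _ _)).zero).trans ?_
    exact Limits.comp_zero)

lemma wittComplex_shortExact (N : ℕ) (hN : N ≠ 0) : (wittComplex X N hN).ShortExact := by
  refine ShortComplex.shortExact_of_iso ?_ ((presheafComplex_shortExact X N hN).map_of_exact
    (presheafToSheaf (Opens.grothendieckTopology X) AddCommGrpCat.{u}))
  -- Only the first term differs from the sheafified presheaf complex: there O_X is replaced by its
  -- sheafification.
  refine ShortComplex.isoMk (sheafificationIso (structureSheaf X)).symm (Iso.refl _) (Iso.refl _)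
    ?_ ?_
  · refine Eq.trans ?_ (Category.comp_id _).symm
    exact (Iso.inv_comp_eq _).2 (verschiebungO_eq X N hN)
  · exact (Category.id_comp _).trans (Category.comp_id _).symm

lemma wittTrunc_comp {n k l : ℕ} (h : k ≤ n) (h' : l ≤ k) :
    wittTrunc X h ≫ wittTrunc X h' = wittTrunc X (h'.trans h) := by
  refine ((presheafToSheaf _ _).map_comp (presheafTrunc X h) (presheafTrunc X h')).symm.trans
    (congrArg (presheafToSheaf _ _).map ?_)
  rw [presheafTrunc, presheafTrunc, presheafTrunc, ← truncNat_comp h h']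
  exact (Functor.whiskerLeft_comp _ _ _).symm

lemma wittTrunc_refl (n : ℕ) : wittTrunc X (le_refl n) = 𝟙 _ := by
  refine Eq.trans (congrArg (presheafToSheaf _ _).map ?_)
    ((presheafToSheaf _ _).map_id (wittPresheaf X n))
  rw [presheafTrunc, truncNat_refl]
  rfl

/-- A truncation is a composite of one-step truncations, so lifts can be chosen one length at a
time. -/
lemma H_map_wittTrunc_surjective {n k : ℕ} (h : k ≤ n) (j : ℕ)
    (hs : ∀ N, k < N → Function.Surjective (Sheaf.H.map (wittTrunc X (Nat.sub_le N 1)) j)) :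
    Function.Surjective (Sheaf.H.map (wittTrunc X h) j) := by
  induction n, h using Nat.le_induction with
  | base =>
    intro x
    exact ⟨x, by rw [wittTrunc_refl, Sheaf.H.map_id_apply]⟩
  | succ n hn ih =>
    intro x
    obtain ⟨y, rfl⟩ := ih x
    obtain ⟨z, rfl⟩ := hs (n + 1) (by omega) y
    refine ⟨z, ?_⟩
    rw [← Sheaf.H.map_comp_apply]
    exact congrArg (fun f => Sheaf.H.map f j z) (wittTrunc_comp X (Nat.sub_le (n + 1) 1) hn).symm

variable {X} {A : Type u} [CommRing A] [Module.Flat ℤ A]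

/-- Free over A implies flat over A, hence flat over ℤ by transitivity, hence torsion-free. -/
lemma nsmul_injective_of_free (M : Type*) [AddCommGroup M] [Module A M]
    [Module.Free A M] {n : ℕ} (hn : n ≠ 0) : Function.Injective fun x : M => n • x := by
  have := Module.Flat.trans ℤ A M
  intro x y hxy
  refine smul_right_injective M (Int.natCast_ne_zero.2 hn) ?_
  simpa only [natCast_zsmul] using hxy

lemma H_map_verschiebungO_injective (f : X ⟶ Spec (CommRingCat.of A)) (j : ℕ)
    (hfree : Module.Free A (HO f j)) (N : ℕ) (hN : N ≠ 0) :
    Function.Injective (Sheaf.H.map (verschiebungO X N hN) j) :=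
  H_map_injective_of_comp_eq_nsmul _ _ (verschiebungO_comp_ghostO X N hN)
    (nsmul_injective_of_free (A := A) (HO f j) hN)

end Scheme

end GenWitt

end

theorem proposition6 {A : Type u} [CommRing A] [Module.Flat ℤ A] {X : Scheme.{u}}
    (f : X ⟶ Spec (CommRingCat.of A))
    (hfree : ∀ j : ℕ, Module.Free A (GenWitt.HO f j))
    (N : ℕ) (hN : 2 ≤ N) (j : ℕ) :
    (Function.Injective (Sheaf.H.map (GenWitt.verschiebungO X N (by omega)) j) ∧
      Function.Exact (Sheaf.H.map (GenWitt.verschiebungO X N (by omega)) j)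
        (Sheaf.H.map (GenWitt.wittTrunc X (Nat.sub_le N 1)) j) ∧
      Function.Surjective (Sheaf.H.map (GenWitt.wittTrunc X (Nat.sub_le N 1)) j)) ∧
    Function.Surjective (Sheaf.H.map (GenWitt.truncO X N (by omega)) j) := by
  have h (M : ℕ) (hM : M ≠ 0) := GenWitt.H_map_exact_and_surjective
    (GenWitt.wittComplex_shortExact X M hM) j
    -- Surjectivity in degree j uses injectivity of the Verschiebung in degree j + 1, which is why
    -- freeness is needed beyond degree j.
    (GenWitt.H_map_verschiebungO_injective f (j + 1) (hfree _) M hM)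
  refine ⟨⟨GenWitt.H_map_verschiebungO_injective f j (hfree j) N (by omega),
    h N (by omega)⟩, fun x => ?_⟩
  -- The class x is first moved to W_1 O_X by a ↦ [a], where it can be lifted step by step up to
  -- length N.
  obtain ⟨y, hy⟩ := GenWitt.H_map_wittTrunc_surjective X (show 1 ≤ N by omega) j
    (fun M hM => (h M (by omega)).2) (Sheaf.H.map (GenWitt.structureSheafIso X).hom j x)
  refine ⟨y, ?_⟩
  rw [GenWitt.truncO, Sheaf.H.map_comp_apply, hy, ← Sheaf.H.map_comp_apply, Iso.hom_inv_id,
    Sheaf.H.map_id_apply]
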